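/- Let $\mathbb F$ be $\mathbb R$ or $\mathbb C$; all locally convex spaces are over $\mathbb F$, and topological spaces are Tychonoff (completely regular Hausdorff). Let $E$ be a locally convex space and $E'$ its space of continuous linear functionals. A barrel in $E$ is a closed, absolutely convex, absorbing subset of $E$. A set $A\subseteq E$ is barrel-bounded if for every barrel $U\subseteq E$ there is $n\in\mathbb N$ with $A\subseteq nU$, and barrel-precompact if for every barrel $U\subseteq E$ there is a finite set $F\subseteq E$ with $A\subseteq F+U$. A barrel-bounded set $A\subseteq E$ is limited if every sequence in $E'$ that converges to $0$ in the weak$^*$ topology converges to $0$ uniformly on $A$. The space $E$ is Gelfand–Phillips if every limited subset of $E$ is barrel-precompact. A topological space $X$ is pseudocompact if every continuous real-valued function on $X$ is bounded. For a pseudocompact space $X$, let $C_p(X)$ be the space of all continuous functions $X\to\mathbb F$ with the topology of pointwise convergence, and let $C(X)$ be the Banach space of all continuous functions $X\to\mathbb F$ with the supremum norm. **Proposition.** Let $f:L\to K$ be a continuous surjection between pseudocompact Tychonoff spaces. If $C_p(L)$ is Gelfand–Phillips, then so is $C_p(K)$. If $C(L)$ is Gelfand–Phillips, then so is $C(K)$.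 -/

import Mathlib

open Filter Topology
open scoped Pointwise

section GelfandPhillips

open scoped ComplexOrder

variable (𝕜 : Type*) [RCLike 𝕜] {E : Type*} [AddCommGroup E] [Module 𝕜 E] [TopologicalSpace E]

/-- A barrel: a closed, absolutely convex, absorbing set. Convexity over `𝕜` is taken with respect
to the order of `𝕜` in which the nonnegative elements are the nonnegative reals, so it is the usual
(real) convexity. -/
structure IsBarrel (B : Set E) : Prop where
  isClosed : IsClosed B
  absConvex : AbsConvex 𝕜 B
  absorbent : Absorbent 𝕜 B

/-- `A` is barrel-bounded, i.e. bounded in the topology whose neighbourhood base at zero consists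
of all barrels. -/
def IsBarrelBounded (A : Set E) : Prop :=
  ∀ U : Set E, IsBarrel 𝕜 U → ∃ n : ℕ, A ⊆ (n : 𝕜) • U

/-- `A` is barrel-precompact, i.e. precompact in the topology whose neighbourhood base at zero
consists of all barrels. -/
def IsBarrelPrecompact (A : Set E) : Prop :=
  ∀ U : Set E, IsBarrel 𝕜 U → ∃ F : Set E, F.Finite ∧ A ⊆ F + U

/-- A barrel-bounded set is limited if every weak* null sequence of continuous linear functionals
converges to zero uniformly on it. -/
def IsLimited (A : Set E) : Prop :=
  IsBarrelBounded 𝕜 A ∧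
    ∀ χ : ℕ → WeakDual 𝕜 E, Tendsto χ atTop (𝓝 0) →
      TendstoUniformlyOn (fun n x => χ n x) (fun _ => (0 : 𝕜)) atTop A

variable (E) in
/-- The Gelfand–Phillips property: every limited set is barrel-precompact. -/
def IsGelfandPhillips : Prop :=
  ∀ A : Set E, IsLimited 𝕜 A → IsBarrelPrecompact 𝕜 A

end GelfandPhillips

section FunctionSpaces

/-- A topological space is pseudocompact if every continuous real-valued function on it is
bounded. -/
def IsPseudocompact (X : Type*) [TopologicalSpace X] : Prop :=
  ∀ f : C(X, ℝ), Bornology.IsBounded (Set.range f)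

/-- On a pseudocompact space every continuous scalar function is bounded; thus the Banach space
`C(X)` of all continuous functions with the supremum norm is `BoundedContinuousFunction X 𝕜`. -/
theorem IsPseudocompact.exists_boundedContinuousFunction {𝕜 : Type*} [RCLike 𝕜] {X : Type*}
    [TopologicalSpace X] (hX : IsPseudocompact X) (f : C(X, 𝕜)) :
    ∃ g : BoundedContinuousFunction X 𝕜, g.toContinuousMap = f := by
  obtain ⟨C, hC⟩ := (hX ⟨fun x => ‖f x‖, by fun_prop⟩).exists_norm_le
  refine ⟨BoundedContinuousFunction.ofNormedAddCommGroup f f.continuous C fun x => ?_, ?_⟩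
  · simpa using hC _ ⟨x, rfl⟩
  · ext x
    rfl

/-- The space `C_p(X)` of continuous `𝕜`-valued functions on `X`, with the topology of pointwise
convergence. -/
def Cp (X 𝕜 : Type*) [TopologicalSpace X] [TopologicalSpace 𝕜] : Type _ := C(X, 𝕜)

variable (X 𝕜 : Type*) [TopologicalSpace X] [RCLike 𝕜]

noncomputable instance : AddCommGroup (Cp X 𝕜) := inferInstanceAs (AddCommGroup C(X, 𝕜))

noncomputable instance : Module 𝕜 (Cp X 𝕜) := inferInstanceAs (Module 𝕜 C(X, 𝕜))

instance : TopologicalSpace (Cp X 𝕜) :=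
  TopologicalSpace.induced (fun (f : C(X, 𝕜)) (x : X) => f x) Pi.topologicalSpace

end FunctionSpaces

/-!
Composition with `f` is an injective continuous linear map `T` from the functions on `K` to those
on `L`, for both topologies. Continuous linear maps preserve limited sets, so if `A` is limited then
`T A` is limited, hence barrel-precompact by hypothesis. What remains is to pull precompactness back
along `T`, and for this it is enough that barrels of the domain contain preimages of (differences
of) barrels of the target: `IsGelfandPhillips.of_preimage_sub_subset`.

Surjectivity of `f` makes `T` isometric for the supremum norm, so it suffices that barrels are
detected by this norm. On the one hand a sup-norm ball is a barrel, even in `C_p(L)`, where it is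
absorbing exactly because `L` is pseudocompact (`Cp.isBarrel_supBall`). On the other hand a barrel
of `C_p(K)` is also a barrel of the Banach space `C(K)`, and by the Baire category theorem it
contains a sup-norm ball (`IsBarrel.exists_ball_subset`).
-/

section Barrels

open scoped ComplexOrder

variable {𝕜 : Type*} [RCLike 𝕜]
  {E : Type*} [AddCommGroup E] [Module 𝕜 E] [TopologicalSpace E]
  {F : Type*} [AddCommGroup F] [Module 𝕜 F] [TopologicalSpace F]

theorem IsBarrel.preimage {U : Set F} (hU : IsBarrel 𝕜 U) (T : E →L[𝕜] F) :
    IsBarrel 𝕜 (T ⁻¹' U) where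
  isClosed := hU.isClosed.preimage T.continuous
  absConvex := by
    refine ⟨?_, hU.absConvex.2.linear_preimage (T : E →ₗ[𝕜] F)⟩
    rintro a ha _ ⟨x, hx, rfl⟩
    exact hU.absConvex.1 a ha ⟨T x, hx, (map_smul T a x).symm⟩
  absorbent := by
    rw [absorbent_iff_eventually_nhdsNE_zero]
    intro x
    filter_upwards [absorbent_iff_eventually_nhdsNE_zero.1 hU.absorbent (T x)] with c hc
    simpa using hc

theorem IsLimited.image {A : Set E} (hA : IsLimited 𝕜 A) (T : E →L[𝕜] F) :
    IsLimited 𝕜 (T '' A) := by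
  refine ⟨fun U hU => ?_, fun χ hχ => ?_⟩
  · obtain ⟨n, hn⟩ := hA.1 _ (hU.preimage T)
    refine ⟨n, ?_⟩
    rintro _ ⟨x, hx, rfl⟩
    obtain ⟨y, hy, rfl⟩ := hn hx
    exact ⟨T y, hy, (map_smul T _ y).symm⟩
  · let ψ : ℕ → WeakDual 𝕜 E := fun n =>
      StrongDual.toWeakDual ((WeakDual.toStrongDual (χ n)).comp T)
    have hψ : Tendsto ψ atTop (𝓝 0) := by
      refine (WeakBilin.tendsto_iff_forall_eval_tendsto _
        ContinuousLinearMap.coe_injective).2 fun x => ?_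
      exact ((WeakDual.eval_continuous (T x)).tendsto 0).comp hχ
    have h := hA.2 ψ hψ
    rw [Metric.tendstoUniformlyOn_iff] at h ⊢
    intro ε hε
    filter_upwards [h ε hε] with n hn
    rintro _ ⟨x, hx, rfl⟩
    exact hn x hx

/-- The Gelfand–Phillips property passes to the domain of a continuous linear map `T` that reflects
barrels. The difference `V - V` leaves room to move the finite set of centres into the range of
`T`. -/
theorem IsGelfandPhillips.of_preimage_sub_subset (T : E →L[𝕜] F)
    (hT : ∀ U : Set E, IsBarrel 𝕜 U → ∃ V : Set F, IsBarrel 𝕜 V ∧ T ⁻¹' (V - V) ⊆ U)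
    (hF : IsGelfandPhillips 𝕜 F) : IsGelfandPhillips 𝕜 E := by
  intro A hA U hU
  obtain ⟨V, hV, hVU⟩ := hT U hU
  obtain ⟨S, hS, hAS⟩ := hF _ (hA.image T) V hV
  have hc : ∀ s : F, ∃ e : E, (∃ x, T x ∈ s +ᵥ V) → T e ∈ s +ᵥ V := fun s => by
    by_cases h : ∃ x, T x ∈ s +ᵥ V
    · exact ⟨h.choose, fun _ => h.choose_spec⟩
    · exact ⟨0, fun h' => absurd h' h⟩
  choose e he using hc
  refine ⟨e '' S, hS.image e, fun x hx => ?_⟩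
  obtain ⟨s, hs, v, hv, hsv⟩ := hAS ⟨x, hx, rfl⟩
  obtain ⟨w, hw, hsw⟩ := he s ⟨x, v, hv, hsv⟩
  refine ⟨e s, ⟨s, hs, rfl⟩, x - e s, hVU ⟨v, hv, w, hw, ?_⟩, by simp⟩
  simp only [vadd_eq_add] at hsv hsw
  rw [map_sub, ← hsv, ← hsw]
  exact (add_sub_add_left_eq_sub v w s).symm

/-- Banach spaces are barrelled. -/
theorem IsBarrel.exists_ball_subset {E : Type*} [NormedAddCommGroup E] [NormedSpace 𝕜 E]
    [CompleteSpace E] {U : Set E} (hU : IsBarrel 𝕜 U) :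
    ∃ r > 0, Metric.ball (0 : E) r ⊆ U := by
  -- By Baire, some multiple of `U` has an interior point, hence so does `U` itself.
  have hcover : ⋃ n : ℕ, (fun x : E => ((n : 𝕜) + 1)⁻¹ • x) ⁻¹' U = Set.univ := by
    refine Set.eq_univ_of_forall fun x => Set.mem_iUnion.2 ?_
    have h := absorbent_iff_eventually_nhdsNE_zero.1 hU.absorbent x
    have ht : Tendsto (fun n : ℕ => ((n : 𝕜) + 1)⁻¹) atTop (𝓝 0) := by
      simpa using tendsto_one_div_add_atTop_nhds_zero_nat (𝕜 := 𝕜)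
    have ht' : Tendsto (fun n : ℕ => ((n : 𝕜) + 1)⁻¹) atTop (𝓝[≠] 0) :=
      tendsto_nhdsWithin_iff.2 ⟨ht, .of_forall fun n => inv_ne_zero (Nat.cast_add_one_ne_zero n)⟩
    exact (ht'.eventually h).exists
  obtain ⟨n, u, hu⟩ := nonempty_interior_of_iUnion_of_closed
    (fun n : ℕ => hU.isClosed.preimage (continuous_const_smul ((n : 𝕜) + 1)⁻¹)) hcover
  obtain ⟨r, hr, hball⟩ := Metric.mem_nhds_iff.1 (mem_interior_iff_mem_nhds.1 hu)
  have hn : (0 : ℝ) < (n : ℝ) + 1 := by positivity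
  have hn' : ((n : 𝕜) + 1) ≠ 0 := Nat.cast_add_one_ne_zero n
  have hnn : ‖(n : 𝕜) + 1‖ = (n : ℝ) + 1 := by
    rw [← Nat.cast_succ, RCLike.norm_natCast, Nat.cast_succ]
  refine ⟨r / (n + 1), by positivity, fun v hv => ?_⟩
  have hmem : ∀ w : E, ‖w‖ < r / (n + 1) → ((n : 𝕜) + 1)⁻¹ • u + w ∈ U := fun w hw => by
    have : u + ((n : 𝕜) + 1) • w ∈ Metric.ball u r := by
      rw [mem_ball_iff_norm, add_sub_cancel_left, norm_smul, hnn, mul_comm]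
      exact (lt_div_iff₀ hn).1 hw
    simpa [smul_add, smul_smul, hn'] using hball this
  rw [mem_ball_zero_iff] at hv
  -- `v` is the midpoint of `c + v` and `-(c - v)`, where `c` is the interior point found.
  have h₁ := hmem v hv
  have h₂ := hU.absConvex.1.neg_mem_iff.2 (hmem (-v) (by simpa using hv))
  have h2 : (0 : 𝕜) ≤ 2⁻¹ := by
    rw [← RCLike.ofReal_ofNat, ← RCLike.ofReal_inv, RCLike.ofReal_nonneg]
    norm_num
  have key := hU.absConvex.2 h₁ h₂ h2 h2 (by rw [← two_mul]; exact mul_inv_cancel₀ two_ne_zero)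
  convert key using 1
  rw [← smul_add, eq_inv_smul_iff₀ two_ne_zero, two_smul]
  abel

end Barrels

section FunctionSpaces

variable {𝕜 : Type*} [RCLike 𝕜] {X Y : Type*} [TopologicalSpace X] [TopologicalSpace Y]

namespace Cp

variable (𝕜) in
/-- Evaluation at `x` as a continuous linear functional on `C_p(X)`. -/
noncomputable def eval (x : X) : Cp X 𝕜 →L[𝕜] 𝕜 where
  toFun g := (show C(X, 𝕜) from g) x
  map_add' _ _ := rfl
  map_smul' _ _ := rfl
  cont := (continuous_apply x).comp continuous_induced_dom

theorem continuous_of_eval {Z : Type*} [TopologicalSpace Z] {F : Z → Cp X 𝕜}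
    (h : ∀ x, Continuous fun z => eval 𝕜 x (F z)) : Continuous F :=
  continuous_induced_rng.2 (continuous_pi h)

/-- Composition with a continuous map `f : X → Y`, as a map `C_p(Y) → C_p(X)`. -/
noncomputable def comp (f : C(X, Y)) : Cp Y 𝕜 →L[𝕜] Cp X 𝕜 where
  toFun g := (show C(Y, 𝕜) from g).comp f
  map_add' _ _ := rfl
  map_smul' _ _ := rfl
  cont := continuous_of_eval fun x => (eval 𝕜 (f x)).continuous

variable (X 𝕜) in
/-- The identity from bounded continuous functions with the supremum norm to `C_p(X)`. -/
noncomputable def ofBounded : BoundedContinuousFunction X 𝕜 →L[𝕜] Cp X 𝕜 where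
  toFun g := g.toContinuousMap
  map_add' _ _ := rfl
  map_smul' _ _ := rfl
  cont := continuous_of_eval fun _ => (BoundedContinuousFunction.lipschitz_eval_const _).continuous

variable (X 𝕜) in
/-- The closed sup-norm ball of radius `r` about zero, as a subset of `C_p(X)`. -/
def supBall (r : ℝ) : Set (Cp X 𝕜) := {g | ∀ x, ‖eval 𝕜 x g‖ ≤ r}

open scoped ComplexOrder in
theorem isBarrel_supBall (hX : IsPseudocompact X) {r : ℝ} (hr : 0 < r) :
    IsBarrel 𝕜 (supBall 𝕜 X r) where
  isClosed := by
    rw [supBall, Set.ofPred_forall]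
    exact isClosed_iInter fun x => isClosed_le (eval 𝕜 x).continuous.norm continuous_const
  absConvex := by
    constructor
    · rintro a ha _ ⟨g, hg, rfl⟩ x
      simp only [map_smul, norm_smul]
      calc ‖a‖ * ‖eval 𝕜 x g‖ ≤ 1 * r := by gcongr; exact hg x
        _ = r := one_mul r
    · intro g hg h hh a b ha hb hab x
      have hab' : ‖a‖ + ‖b‖ = 1 := by
        have : ((‖a‖ + ‖b‖ : ℝ) : 𝕜) = ((1 : ℝ) : 𝕜) := by
          rw [RCLike.ofReal_add, RCLike.norm_of_nonneg' ha, RCLike.norm_of_nonneg' hb, hab,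
            RCLike.ofReal_one]
        exact RCLike.ofReal_injective this
      simp only [map_add, map_smul]
      calc ‖a • eval 𝕜 x g + b • eval 𝕜 x h‖
          ≤ ‖a‖ * ‖eval 𝕜 x g‖ + ‖b‖ * ‖eval 𝕜 x h‖ := by
            simpa only [norm_smul] using norm_add_le (a • eval 𝕜 x g) (b • eval 𝕜 x h)
        _ ≤ ‖a‖ * r + ‖b‖ * r := by gcongr; exacts [hg x, hh x]
        _ = r := by rw [← add_mul, hab', one_mul]
  absorbent := by
    rw [absorbent_iff_eventually_nhdsNE_zero]
    intro g
    obtain ⟨g, rfl⟩ : ∃ g', ofBounded 𝕜 X g' = g := hX.exists_boundedContinuousFunction g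
    have ht : Tendsto (fun c : 𝕜 => ‖c • g‖) (𝓝 0) (𝓝 0) := by
      have : Continuous fun c : 𝕜 => ‖c • g‖ := by fun_prop
      simpa using this.tendsto 0
    filter_upwards [nhdsWithin_le_nhds (ht.eventually (gt_mem_nhds hr))] with c hc x
    exact ((c • g).norm_coe_le_norm x).trans hc.le

theorem supBall_sub_subset (r : ℝ) : supBall 𝕜 X r - supBall 𝕜 X r ⊆ supBall 𝕜 X (r + r) := by
  rintro _ ⟨g, hg, h, hh, rfl⟩ x
  rw [map_sub]
  exact (norm_sub_le _ _).trans (add_le_add (hg x) (hh x))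

theorem preimage_comp_supBall (f : C(X, Y)) (hf : Function.Surjective f) (r : ℝ) :
    comp f ⁻¹' supBall 𝕜 X r = supBall 𝕜 Y r := by
  ext g
  exact hf.forall (p := fun y => ‖eval 𝕜 y g‖ ≤ r) |>.symm

end Cp

theorem IsBarrel.exists_preimage_supBall_subset {U : Set (BoundedContinuousFunction X 𝕜)}
    (hU : IsBarrel 𝕜 U) : ∃ r > 0, Cp.ofBounded 𝕜 X ⁻¹' Cp.supBall 𝕜 X (r + r) ⊆ U := by
  obtain ⟨r, hr, h⟩ := hU.exists_ball_subset
  refine ⟨r / 4, by positivity, fun g hg => h ?_⟩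
  rw [mem_ball_zero_iff]
  have : ‖g‖ ≤ r / 4 + r / 4 := (g.norm_le (by positivity)).2 hg
  linarith

theorem IsBarrel.exists_supBall_subset (hX : IsPseudocompact X) {U : Set (Cp X 𝕜)}
    (hU : IsBarrel 𝕜 U) : ∃ r > 0, Cp.supBall 𝕜 X (r + r) ⊆ U := by
  obtain ⟨r, hr, h⟩ := (hU.preimage (Cp.ofBounded 𝕜 X)).exists_preimage_supBall_subset
  refine ⟨r, hr, fun g hg => ?_⟩
  obtain ⟨g, rfl⟩ : ∃ g', Cp.ofBounded 𝕜 X g' = g := hX.exists_boundedContinuousFunction g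
  exact h hg

variable (𝕜) in
/-- Composition with a continuous map `f : X → Y`, as a contraction between the spaces of bounded
continuous functions. -/
noncomputable def BoundedContinuousFunction.compRightCLM (f : C(X, Y)) :
    BoundedContinuousFunction Y 𝕜 →L[𝕜] BoundedContinuousFunction X 𝕜 where
  toFun g := g.compContinuous f
  map_add' _ _ := rfl
  map_smul' _ _ := rfl
  cont := BoundedContinuousFunction.continuous_compContinuous f

end FunctionSpaces

theorem proposition3p8 {𝕜 : Type*} [RCLike 𝕜] {L K : Type*}
    [TopologicalSpace L] [T35Space L] [TopologicalSpace K] [T35Space K]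
    (hL : IsPseudocompact L) (hK : IsPseudocompact K)
    (f : L → K) (hf : Continuous f) (hsurj : Function.Surjective f) :
    (IsGelfandPhillips 𝕜 (Cp L 𝕜) → IsGelfandPhillips 𝕜 (Cp K 𝕜)) ∧
      (IsGelfandPhillips 𝕜 (BoundedContinuousFunction L 𝕜) →
        IsGelfandPhillips 𝕜 (BoundedContinuousFunction K 𝕜)) := by
  let φ : C(L, K) := ⟨f, hf⟩
  constructor
  · refine IsGelfandPhillips.of_preimage_sub_subset (Cp.comp φ) fun U hU => ?_
    obtain ⟨r, hr, hrU⟩ := hU.exists_supBall_subset hK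
    refine ⟨_, Cp.isBarrel_supBall hL hr, Set.Subset.trans ?_ hrU⟩
    rw [← Cp.preimage_comp_supBall φ hsurj]
    exact Set.preimage_mono (Cp.supBall_sub_subset r)
  · refine IsGelfandPhillips.of_preimage_sub_subset
      (BoundedContinuousFunction.compRightCLM 𝕜 φ) fun U hU => ?_
    obtain ⟨r, hr, hrU⟩ := hU.exists_preimage_supBall_subset
    refine ⟨_, (Cp.isBarrel_supBall hL hr).preimage (Cp.ofBounded 𝕜 L),
      Set.Subset.trans ?_ hrU⟩
    rw [← Cp.preimage_comp_supBall φ hsurj]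
    rintro g ⟨v, hv, w, hw, hvw⟩
    refine Cp.supBall_sub_subset r ⟨_, hv, _, hw, ?_⟩
    exact (map_sub (Cp.ofBounded 𝕜 L) v w).symm.trans (congrArg (Cp.ofBounded 𝕜 L) hvw)
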